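/- Let $d\ge 1$ be an integer and let $0<s<d/2$. There is a constant $C>0$, depending only on $d$ and $s$, such that for every $N$ and all functions $f_1,\ldots,f_N$ that are orthonormal in the complex Hilbert space $L^2(\mathbb{R}^d)$ the following holds. For each $n$ the integral $$ \bigl(|x|^{-d+s} * f_n\bigr)(x)=\int_{\mathbb{R}^d} |t|^{-d+s} f_n(x-t)\,dt $$ converges absolutely for almost every $x\in\mathbb{R}^d$, the function $\bigl( \sum_{n=1}^N \bigl| |x|^{-d+s} * f_n \bigr|^2 \bigr)^{d/(d-2s)}$ is integrable on $\mathbb{R}^d$, and $$ \int_{\mathbb{R}^d} \left( \sum_{n=1}^N \left| |x|^{-d+s} * f_n \right|^2 \right)^{d/(d-2s)}dx \le C\, N . $$ -/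

import Mathlib

open MeasureTheory
open scoped Convolution

noncomputable section

/-- The kernel `|x|^{-d+s}` on `ℝ^d` (Euclidean norm). Its value at the single point `x = 0`
is irrelevant for integrals when `d ≥ 1`. -/
def rieszKernel (d : ℕ) (s : ℝ) (x : EuclideanSpace ℝ (Fin d)) : ℝ :=
  ‖x‖ ^ (-(d : ℝ) + s)

/-- The convolution `(|x|^{-d+s} * f)(x) = ∫ |t|^{-d+s} f(x - t) dt` of the kernel with a
complex-valued function, with respect to Lebesgue measure. -/
def rieszConv (d : ℕ) (s : ℝ) (f : EuclideanSpace ℝ (Fin d) → ℂ) :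
    EuclideanSpace ℝ (Fin d) → ℂ :=
  rieszKernel d s ⋆[ContinuousLinearMap.lsmul ℝ ℝ, volume] f

/-- The integral that defines `rieszConv d s f x` converges absolutely. -/
def RieszConvExistsAt (d : ℕ) (s : ℝ) (f : EuclideanSpace ℝ (Fin d) → ℂ)
    (x : EuclideanSpace ℝ (Fin d)) : Prop :=
  ConvolutionExistsAt (rieszKernel d s) f x (ContinuousLinearMap.lsmul ℝ ℝ) volume

end

/-! Collect the functions into one map `F = (f_1, …, f_N)` with values in `ℂ^N`, so the sum is `|K *
F|^2`, with `K` the kernel, and `∫ |F|^2 = N`. Split `K` at a radius `R`. The far part is in `L²`,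
and Bessel bounds its convolution with `F` pointwise by its `L²` norm, of order `R^(s-d/2)`,
whatever `N` is; only here does orthogonality enter. The near part has mass of order `R^s`: where
`|F| ≤ m` it contributes at most a multiple of `R^s m`, and where `|F| > m` Tonelli and Markov
apply.

With `R = m^(-2/d)` both pointwise bounds have size `m^θ`, `θ = (d-2s)/d`, which gives the weak-type
estimate `exists_meas_lt_norm_integral_rieszKernel_mul_le`. Keeping `∫_{|F|>m} |F|` on its right
side lets `lintegral_sq_le_of_meas_lt_mul_le` integrate over levels up to a multiple of `∫ |F|^2`.
-/

/-! ### Radial power integrals and the kernel -/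

open Set in
theorem integrableOn_norm_rpow_iff {E : Type*} [NormedAddCommGroup E] [NormedSpace ℝ E]
    [Nontrivial E] [FiniteDimensional ℝ E] [MeasurableSpace E] [BorelSpace E] (μ : Measure E)
    [μ.IsAddHaarMeasure] {S : Set ℝ} (hS : MeasurableSet S) (a : ℝ) :
    IntegrableOn (fun x : E => ‖x‖ ^ a) ((‖·‖) ⁻¹' S) μ ↔
      IntegrableOn (fun y : ℝ => y ^ ((Module.finrank ℝ E : ℝ) - 1 + a)) (Ioi 0 ∩ S) := by
  have h1 : ((‖·‖) ⁻¹' S).indicator (fun x : E => ‖x‖ ^ a)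
      = fun x : E => S.indicator (fun y : ℝ => y ^ a) ‖x‖ := by
    rfl
  rw [← integrable_indicator_iff (measurable_norm hS), h1, integrable_fun_norm_addHaar μ,
    inter_comm, IntegrableOn, IntegrableOn, ← Measure.restrict_restrict hS, ← IntegrableOn,
    ← IntegrableOn, ← integrable_indicator_iff hS, ← IntegrableOn]
  refine integrableOn_congr_fun (fun y hy => ?_) measurableSet_Ioi
  have hn : 1 ≤ Module.finrank ℝ E := Module.finrank_pos
  by_cases hyS : y ∈ S
  · simp only [indicator_of_mem hyS, smul_eq_mul]
    rw [Real.rpow_add hy, ← Real.rpow_natCast, Nat.cast_sub hn, Nat.cast_one]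
  · simp [hyS]

open Set in
theorem setIntegral_norm_rpow {E : Type*} [NormedAddCommGroup E] [NormedSpace ℝ E]
    [Nontrivial E] [FiniteDimensional ℝ E] [MeasurableSpace E] [BorelSpace E] (μ : Measure E)
    [μ.IsAddHaarMeasure] {S : Set ℝ} (hS : MeasurableSet S) (a : ℝ) :
    ∫ x in (‖·‖) ⁻¹' S, ‖x‖ ^ a ∂μ = Module.finrank ℝ E * μ.real (Metric.ball 0 1) *
      ∫ y in Ioi 0 ∩ S, y ^ ((Module.finrank ℝ E : ℝ) - 1 + a) := by
  have h1 : ((‖·‖) ⁻¹' S).indicator (fun x : E => ‖x‖ ^ a)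
      = fun x : E => S.indicator (fun y : ℝ => y ^ a) ‖x‖ := by
    rfl
  rw [← integral_indicator (measurable_norm hS), h1, integral_fun_norm_addHaar μ,
    inter_comm, ← Measure.restrict_restrict hS, ← integral_indicator hS, nsmul_eq_mul, smul_eq_mul,
    mul_assoc]
  congr 2
  refine setIntegral_congr_fun measurableSet_Ioi (fun y hy => ?_)
  have hn : 1 ≤ Module.finrank ℝ E := Module.finrank_pos
  by_cases hyS : y ∈ S
  · simp only [indicator_of_mem hyS, smul_eq_mul]
    rw [Real.rpow_add hy, ← Real.rpow_natCast, Nat.cast_sub hn, Nat.cast_one]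
  · simp [hyS]

theorem rieszKernel_nonneg (d : ℕ) (s : ℝ) (x : EuclideanSpace ℝ (Fin d)) :
    0 ≤ rieszKernel d s x :=
  Real.rpow_nonneg (norm_nonneg _) _

theorem rieszKernel_sq (d : ℕ) (s : ℝ) (x : EuclideanSpace ℝ (Fin d)) :
    rieszKernel d s x ^ 2 = ‖x‖ ^ (-2 * (d : ℝ) + 2 * s) := by
  rw [rieszKernel, ← Real.rpow_mul_natCast (norm_nonneg _)]
  congr 1; push_cast; ring

theorem measurable_rieszKernel (d : ℕ) (s : ℝ) : Measurable (rieszKernel d s) :=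
  measurable_norm.pow_const _

open Set in
/-- The kernel is integrable near the origin, with the expected scaling. -/
theorem exists_integral_rieszKernel_ball (d : ℕ) (hd : 0 < d) {s : ℝ} (hs : 0 < s) :
    ∃ B : ℝ, 0 < B ∧ ∀ R : ℝ, 0 < R → IntegrableOn (rieszKernel d s) (Metric.ball 0 R) ∧
      ∫ t in Metric.ball 0 R, rieszKernel d s t = B * R ^ s := by
  have : NeZero d := ⟨hd.ne'⟩
  refine ⟨d * volume.real (Metric.ball (0 : EuclideanSpace ℝ (Fin d)) 1) / s, ?_, fun R hR => ?_⟩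
  · have : 0 < volume.real (Metric.ball (0 : EuclideanSpace ℝ (Fin d)) 1) :=
      ENNReal.toReal_pos (Metric.measure_ball_pos _ _ one_pos).ne' measure_ball_lt_top.ne
    positivity
  have hball : Metric.ball (0 : EuclideanSpace ℝ (Fin d)) R = (‖·‖) ⁻¹' Iio R := by
    ext x; simp
  have he : ((Module.finrank ℝ (EuclideanSpace ℝ (Fin d)) : ℕ) : ℝ) - 1 + (-(d : ℝ) + s)
      = s - 1 := by
    rw [finrank_euclideanSpace_fin]; ring
  unfold rieszKernel
  constructor
  · rw [hball, integrableOn_norm_rpow_iff volume measurableSet_Iio, he, Ioi_inter_Iio,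
      intervalIntegral.integrableOn_Ioo_rpow_iff hR]
    linarith
  · rw [hball, setIntegral_norm_rpow volume measurableSet_Iio, he, Ioi_inter_Iio,
      ← integral_Ioc_eq_integral_Ioo, ← intervalIntegral.integral_of_le hR.le,
      integral_rpow (Or.inl (by linarith)), finrank_euclideanSpace_fin]
    simp [Real.zero_rpow hs.ne']
    ring

open Set in
/-- The kernel is square integrable away from the origin, with the expected scaling. -/
theorem exists_integral_rieszKernel_sq_compl_ball (d : ℕ) (hd : 0 < d) {s : ℝ}
    (hs : s < (d : ℝ) / 2) :
    ∃ A : ℝ, 0 < A ∧ ∀ R : ℝ, 0 < R →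
      IntegrableOn (fun t => rieszKernel d s t ^ 2) (Metric.ball 0 R)ᶜ ∧
      ∫ t in (Metric.ball 0 R)ᶜ, rieszKernel d s t ^ 2 = A * R ^ (2 * s - d) := by
  have : NeZero d := ⟨hd.ne'⟩
  refine ⟨d * volume.real (Metric.ball (0 : EuclideanSpace ℝ (Fin d)) 1) / (d - 2 * s), ?_,
    fun R hR => ?_⟩
  · have : 0 < volume.real (Metric.ball (0 : EuclideanSpace ℝ (Fin d)) 1) :=
      ENNReal.toReal_pos (Metric.measure_ball_pos _ _ one_pos).ne' measure_ball_lt_top.ne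
    have : 0 < (d : ℝ) - 2 * s := by linarith
    positivity
  have hball : (Metric.ball (0 : EuclideanSpace ℝ (Fin d)) R)ᶜ = (‖·‖) ⁻¹' Ici R := by
    ext x; simp
  have he : ((Module.finrank ℝ (EuclideanSpace ℝ (Fin d)) : ℕ) : ℝ) - 1 + (-2 * (d : ℝ) + 2 * s)
      = 2 * s - d - 1 := by
    rw [finrank_euclideanSpace_fin]; ring
  have hI : Ioi 0 ∩ Ici R = Ici R := inter_eq_right.2 fun y hy => hR.trans_le hy
  have hlt : 2 * s - d - 1 < -1 := by linarith
  simp_rw [rieszKernel_sq]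
  constructor
  · rw [hball, integrableOn_norm_rpow_iff volume measurableSet_Ici, he, hI,
      integrableOn_Ici_iff_integrableOn_Ioi]
    exact integrableOn_Ioi_rpow_of_lt hlt hR
  · rw [hball, setIntegral_norm_rpow volume measurableSet_Ici, he, hI,
      integral_Ici_eq_integral_Ioi, integral_Ioi_rpow_of_lt hlt hR, finrank_euclideanSpace_fin]
    have h1 : (d : ℝ) - 2 * s ≠ 0 := by linarith
    have h2 : 2 * s - (d : ℝ) ≠ 0 := by linarith
    simp only [sub_add_cancel]
    field_simp
    ring

/-! ### Layer cake and Tonelli -/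

open Set in
/-- A tail estimate of Hardy–Littlewood type implies the bound in `L²`. -/
theorem lintegral_sq_le_of_meas_lt_mul_le {α : Type*} [MeasurableSpace α] {μ : Measure α}
    [SFinite μ] {h g : α → ℝ} (h0 : 0 ≤ h) (hh : AEMeasurable h μ) (g0 : 0 ≤ g)
    (hg : Measurable g)
    (H : ∀ m : ℝ, 0 < m →
      μ {x | m < h x} * ENNReal.ofReal m ≤ ∫⁻ x in {x | m < g x}, ENNReal.ofReal (g x) ∂μ) :
    ∫⁻ x, ENNReal.ofReal (h x ^ (2 : ℝ)) ∂μ ≤ 2 * ∫⁻ x, ENNReal.ofReal (g x ^ 2) ∂μ := by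
  rw [lintegral_rpow_eq_lintegral_meas_lt_mul μ (ae_of_all _ h0) hh two_pos]
  have hset : MeasurableSet {q : ℝ × α | q.1 < g q.2} :=
    measurableSet_lt measurable_fst (hg.comp measurable_snd)
  have hmeas : Measurable fun q : ℝ × α =>
      {q : ℝ × α | q.1 < g q.2}.indicator (fun q => ENNReal.ofReal (g q.2)) q :=
    ((hg.comp measurable_snd).ennreal_ofReal).indicator hset
  calc _ = 2 * ∫⁻ t in Ioi (0 : ℝ), μ {x | t < h x} * ENNReal.ofReal t := by
        norm_num
    _ ≤ 2 * ∫⁻ t in Ioi (0 : ℝ), ∫⁻ x,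
          {q : ℝ × α | q.1 < g q.2}.indicator (fun q => ENNReal.ofReal (g q.2)) (t, x) ∂μ := by
        gcongr 2 * ?_
        refine setLIntegral_mono' measurableSet_Ioi fun t ht => (H t ht).trans_eq ?_
        rw [← lintegral_indicator (measurableSet_lt measurable_const hg)]
        rfl
    _ = 2 * ∫⁻ x, (∫⁻ t in Ioi (0 : ℝ),
          {q : ℝ × α | q.1 < g q.2}.indicator (fun q => ENNReal.ofReal (g q.2)) (t, x)) ∂μ := by
        rw [lintegral_lintegral_swap hmeas.aemeasurable]
    _ = 2 * ∫⁻ x, ENNReal.ofReal (g x ^ 2) ∂μ := by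
        congr 1
        refine lintegral_congr fun x => ?_
        have : (fun t : ℝ => {q : ℝ × α | q.1 < g q.2}.indicator
            (fun q => ENNReal.ofReal (g q.2)) (t, x))
            = (Iio (g x)).indicator fun _ => ENNReal.ofReal (g x) := rfl
        rw [this, lintegral_indicator measurableSet_Iio, setLIntegral_const,
          Measure.restrict_apply measurableSet_Iio, inter_comm, Ioi_inter_Iio, Real.volume_Ioo,
          sub_zero, ← ENNReal.ofReal_mul (g0 x), sq]

/-- Tonelli for the convolution of two nonnegative functions. -/
theorem lintegral_lintegral_mul_sub {G : Type*} [AddCommGroup G] [MeasurableSpace G]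
    [MeasurableAdd₂ G] [MeasurableNeg G] {μ : Measure G} [SFinite μ] [μ.IsAddLeftInvariant]
    {φ ψ : G → ENNReal} (hφ : Measurable φ) (hψ : Measurable ψ) (S : Set G) :
    ∫⁻ x, ∫⁻ t in S, φ t * ψ (x - t) ∂μ ∂μ = (∫⁻ t in S, φ t ∂μ) * ∫⁻ x, ψ x ∂μ := by
  have hm : Measurable fun q : G × G => φ q.2 * ψ (q.1 - q.2) :=
    (hφ.comp measurable_snd).mul (hψ.comp (measurable_fst.sub measurable_snd))
  rw [lintegral_lintegral_swap hm.aemeasurable, ← lintegral_mul_const _ hφ]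
  refine lintegral_congr fun t => ?_
  have hψt : Measurable fun x => ψ (x - t) := hψ.comp (measurable_id.sub_const t)
  rw [lintegral_const_mul _ hψt,
    lintegral_sub_right_eq_self ψ t]

/-! ### Convolution with `L²` functions and Bessel's inequality -/

/-- An integrable kernel can be convolved, almost everywhere, with a function in `L²`. -/
theorem ae_integrable_smul_sub_of_integrable_of_memLp_two {d : ℕ} {V : Type*}
    [NormedAddCommGroup V] [NormedSpace ℝ V] {φ : EuclideanSpace ℝ (Fin d) → ℝ}
    {F : EuclideanSpace ℝ (Fin d) → V} (hφ : Integrable φ) (hF : MemLp F 2)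
    (hFm : StronglyMeasurable F) :
    ∀ᵐ x, Integrable fun t => φ t • F (x - t) := by
  -- Since `|F| ≤ 1 + |F|^2` up to a constant, it suffices to convolve `φ` with the integrable
  -- function `|F|^2`.
  filter_upwards [hφ.ae_convolution_exists (ContinuousLinearMap.lsmul ℝ ℝ) hF.norm.integrable_sq]
    with x hx
  refine (hφ.norm.add (Integrable.norm hx)).mono' ?_ (ae_of_all _ fun t => ?_)
  · exact hφ.aestronglyMeasurable.smul
      (hFm.comp_measurable (measurable_const.sub measurable_id)).aestronglyMeasurable
  · simp only [norm_smul, Pi.add_apply, ContinuousLinearMap.lsmul_apply, norm_pow, norm_norm]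
    nlinarith [norm_nonneg (φ t), mul_nonneg (norm_nonneg (φ t)) (sq_nonneg (‖F (x - t)‖ - 1))]

/-- A square integrable kernel can be convolved everywhere with a function in `L²`. -/
theorem integrable_smul_sub_of_memLp_two {d : ℕ} {V : Type*}
    [NormedAddCommGroup V] [NormedSpace ℝ V] {φ : EuclideanSpace ℝ (Fin d) → ℝ}
    {F : EuclideanSpace ℝ (Fin d) → V} (hφ : MemLp φ 2) (hF : MemLp F 2)
    (x : EuclideanSpace ℝ (Fin d)) :
    Integrable fun t => φ t • F (x - t) := by
  have hF' : MemLp (fun t => F (x - t)) 2 :=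
    hF.comp_measurePreserving (Measure.measurePreserving_sub_left volume x)
  exact memLp_one_iff_integrable.1 (hF'.smul hφ)

/-- Bessel's inequality for the convolution of a real kernel with an orthonormal family. -/
theorem sum_norm_integral_smul_sub_sq_le {d N : ℕ}
    {f : Fin N → Lp ℂ 2 (volume : Measure (EuclideanSpace ℝ (Fin d)))} (hf : Orthonormal ℂ f)
    {φ : EuclideanSpace ℝ (Fin d) → ℝ} (hφ : MemLp φ 2) (x : EuclideanSpace ℝ (Fin d)) :
    ∑ n, ‖∫ t, φ t • f n (x - t)‖ ^ 2 ≤ ∫ t, φ t ^ 2 := by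
  -- The reflected translate of `φ` turns each convolution value into an inner product with `f n`.
  have hφ' : MemLp (fun t => (φ (x - t) : ℂ)) 2 :=
    (hφ.comp_measurePreserving (Measure.measurePreserving_sub_left volume x)).ofReal
  set h := hφ'.toLp
  have hco : ⇑h =ᵐ[volume] fun t => (φ (x - t) : ℂ) := hφ'.coeFn_toLp
  have h1 : ∀ n, ∫ t, φ t • f n (x - t) = inner ℂ h (f n) := fun n => by
    rw [← integral_sub_left_eq_self _ volume x, L2.inner_def]
    refine integral_congr_ae ?_
    filter_upwards [hco] with t ht
    simp [ht, mul_comm]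
  have h2 : ‖h‖ ^ 2 = ∫ t, φ t ^ 2 := by
    rw [← integral_sub_left_eq_self _ volume x]
    have : ((‖h‖ ^ 2 : ℝ) : ℂ) = ((∫ t, φ (x - t) ^ 2 : ℝ) : ℂ) := by
      rw [Complex.ofReal_pow, ← Complex.coe_algebraMap,
        ← inner_self_eq_norm_sq_to_K (𝕜 := ℂ), L2.inner_def, Complex.coe_algebraMap,
        ← integral_complex_ofReal]
      refine integral_congr_ae ?_
      filter_upwards [hco] with t ht
      rw [ht, RCLike.inner_apply, Complex.conj_ofReal, sq, Complex.ofReal_mul]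
    exact_mod_cast this
  simp_rw [h1, ← h2, norm_inner_symm h]
  exact hf.sum_inner_products_le h

theorem memLp_two_indicator_rieszKernel {d : ℕ} {s : ℝ} {S : Set (EuclideanSpace ℝ (Fin d))}
    (hS : MeasurableSet S) (h : IntegrableOn (fun t => rieszKernel d s t ^ 2) S) :
    MemLp (S.indicator (rieszKernel d s)) 2 := by
  rw [memLp_indicator_iff_restrict hS,
    memLp_two_iff_integrable_sq (measurable_rieszKernel d s).aestronglyMeasurable]
  exact h

/-- Cut at radius 1, the kernel is the sum of an `L¹` and an `L²` function. -/
theorem ae_integrable_rieszKernel_smul {d : ℕ} {s : ℝ} (hs0 : 0 < s) (hsd : s < (d : ℝ) / 2)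
    {V : Type*} [NormedAddCommGroup V] [NormedSpace ℝ V] {F : EuclideanSpace ℝ (Fin d) → V}
    (hFm : StronglyMeasurable F) (hF : MemLp F 2) :
    ∀ᵐ x, Integrable fun t => rieszKernel d s t • F (x - t) := by
  have hd : 0 < d := by
    have : (0 : ℝ) < d := by linarith
    exact_mod_cast this
  obtain ⟨B, -, hBi⟩ := exists_integral_rieszKernel_ball d hd hs0
  obtain ⟨A, -, hAi⟩ := exists_integral_rieszKernel_sq_compl_ball d hd hsd
  have hb : MeasurableSet (Metric.ball (0 : EuclideanSpace ℝ (Fin d)) 1) := measurableSet_ball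
  filter_upwards [ae_integrable_smul_sub_of_integrable_of_memLp_two
    ((integrable_indicator_iff hb).2 (hBi 1 one_pos).1) hF hFm] with x hx
  refine (hx.add (integrable_smul_sub_of_memLp_two
    (memLp_two_indicator_rieszKernel hb.compl (hAi 1 one_pos).1) hF x)).congr
    (ae_of_all _ fun t => ?_)
  rw [Pi.add_apply, ← add_smul, ← Pi.add_apply (Set.indicator _ _), Set.indicator_self_add_compl]

/-! ### The weak-type estimate -/

open Set in
/-- A convolution integral with the kernel is split at distance `R` from the origin, and the
density is truncated at height `l`. -/
theorem enorm_integral_rieszKernel_smul_le {d : ℕ} {s : ℝ} {V : Type*} [NormedAddCommGroup V]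
    [NormedSpace ℝ V] {F : EuclideanSpace ℝ (Fin d) → V}
    {R l a b : ℝ} (hl : 0 ≤ l) {x : EuclideanSpace ℝ (Fin d)}
    (hx : Integrable fun t => rieszKernel d s t • F (x - t))
    (hb : IntegrableOn (rieszKernel d s) (Metric.ball 0 R))
    (hb' : ∫ t in Metric.ball 0 R, rieszKernel d s t = b)
    (ha : ‖∫ t in (Metric.ball 0 R)ᶜ, rieszKernel d s t • F (x - t)‖ ≤ a) :
    ‖∫ t, rieszKernel d s t • F (x - t)‖ₑ ≤ ENNReal.ofReal (a + b * l) +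
      ∫⁻ t in Metric.ball 0 R, ENNReal.ofReal (rieszKernel d s t) *
        {y | l < ‖F y‖}.indicator (fun y => ‖F y‖ₑ) (x - t) := by
  have ha0 : 0 ≤ a := (norm_nonneg _).trans ha
  have hb0 : 0 ≤ b := hb' ▸ integral_nonneg fun t => rieszKernel_nonneg d s t
  have hKm : Measurable fun t => ENNReal.ofReal (rieszKernel d s t) :=
    (measurable_rieszKernel d s).ennreal_ofReal
  rw [← integral_add_compl measurableSet_ball hx, ENNReal.ofReal_add ha0 (by positivity),
    add_comm (∫ t in Metric.ball _ _, _), add_assoc]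
  refine (enorm_add_le _ _).trans (add_le_add ?_ ?_)
  · rw [← ofReal_norm]
    exact ENNReal.ofReal_le_ofReal ha
  · refine (enorm_integral_le_lintegral_enorm _).trans ?_
    rw [ENNReal.ofReal_mul hb0, ← hb', ofReal_integral_eq_lintegral_ofReal hb
      (ae_of_all _ fun t => rieszKernel_nonneg d s t), ← lintegral_mul_const _ hKm,
      ← lintegral_add_left (hKm.mul_const _)]
    refine lintegral_mono fun t => ?_
    rw [enorm_smul, Real.enorm_of_nonneg (rieszKernel_nonneg d s t), ← mul_add]
    gcongr
    by_cases ht : l < ‖F (x - t)‖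
    · rw [indicator_of_mem (show x - t ∈ {y | l < ‖F y‖} from ht)]
      exact le_add_self
    · rw [← ofReal_norm]
      exact (ENNReal.ofReal_le_ofReal (not_lt.1 ht)).trans le_self_add

open Set in
/-- The weak-type estimate behind the Hardy–Littlewood–Sobolev inequality, for a density that
satisfies Bessel's inequality against square integrable kernels. -/
theorem exists_meas_lt_norm_integral_rieszKernel_mul_le {d : ℕ} {s : ℝ} (hs0 : 0 < s)
    (hsd : s < (d : ℝ) / 2) :
    ∃ D : ℝ, 0 < D ∧ ∀ (N : ℕ) (F : EuclideanSpace ℝ (Fin d) → EuclideanSpace ℂ (Fin N)),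
      StronglyMeasurable F → MemLp F 2 →
      (∀ φ : EuclideanSpace ℝ (Fin d) → ℝ, MemLp φ 2 → ∀ x,
        ‖∫ t, φ t • F (x - t)‖ ^ 2 ≤ ∫ t, φ t ^ 2) →
      ∀ m : ℝ, 0 < m →
        volume {x | 2 * D * m ^ (((d : ℝ) - 2 * s) / d)
            < ‖∫ t, rieszKernel d s t • F (x - t)‖} * ENNReal.ofReal m
          ≤ ∫⁻ x in {x | m < ‖F x‖}, ENNReal.ofReal ‖F x‖ := by
  have hd' : (0 : ℝ) < d := by linarith
  have hd : 0 < d := by exact_mod_cast hd'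
  obtain ⟨B, hB, hBi⟩ := exists_integral_rieszKernel_ball d hd hs0
  obtain ⟨A, hA, hAi⟩ := exists_integral_rieszKernel_sq_compl_ball d hd hsd
  -- `√A` comes from the far part and `B` from the near part at density at most `m`; the factor 2
  -- leaves another `D * m ^ θ` for the high part.
  refine ⟨√A + B, by positivity, fun N F hFm hF hBes m hm => ?_⟩
  set θ := ((d : ℝ) - 2 * s) / d with hθ
  set D := √A + B with hD
  have hD0 : 0 < D := by positivity
  set R := m ^ (-2 / (d : ℝ)) with hRdef
  have hR : 0 < R := Real.rpow_pos_of_pos hm _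
  have hRs : R ^ s = m ^ (θ - 1) := by
    rw [hRdef, ← Real.rpow_mul hm.le]
    congr 1
    rw [hθ]; field_simp; ring
  have hRA : R ^ (2 * s - d) = (m ^ θ) ^ 2 := by
    rw [hRdef, ← Real.rpow_mul hm.le, ← Real.rpow_mul_natCast hm.le]
    congr 1
    rw [hθ]; field_simp; push_cast; ring
  have hmθ : m ^ (θ - 1) * m = m ^ θ := by
    rw [← Real.rpow_add_one hm.ne']; congr 1; ring
  have hmθ0 : 0 < m ^ θ := Real.rpow_pos_of_pos hm _
  have hmθ1 : 0 < m ^ (θ - 1) := Real.rpow_pos_of_pos hm _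
  obtain ⟨hbi, hbe⟩ := hBi R hR
  obtain ⟨hai, hae⟩ := hAi R hR
  have hfar : ∀ x, ‖∫ t in (Metric.ball 0 R)ᶜ, rieszKernel d s t • F (x - t)‖ ≤ √A * m ^ θ := by
    intro x
    have h := hBes _ (memLp_two_indicator_rieszKernel measurableSet_ball.compl hai) x
    have h1 : (fun t => (Metric.ball 0 R)ᶜ.indicator (rieszKernel d s) t • F (x - t))
        = (Metric.ball 0 R)ᶜ.indicator fun t => rieszKernel d s t • F (x - t) :=
      (indicator_smul_left _ _ _).symm
    rw [h1, integral_indicator measurableSet_ball.compl] at h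
    have h2 : (fun t => ((Metric.ball 0 R)ᶜ.indicator (rieszKernel d s) t) ^ 2)
        = (Metric.ball 0 R)ᶜ.indicator fun t => rieszKernel d s t ^ 2 := by
      ext t
      by_cases ht : t ∈ (Metric.ball (0 : EuclideanSpace ℝ (Fin d)) R)ᶜ
      · rw [indicator_of_mem ht, indicator_of_mem ht]
      · rw [indicator_of_notMem ht, indicator_of_notMem ht, zero_pow two_ne_zero]
    rw [h2, integral_indicator measurableSet_ball.compl, hae, hRA] at h
    refine le_of_sq_le_sq (h.trans_eq ?_) (by positivity)
    rw [mul_pow, Real.sq_sqrt hA.le]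
  set ψ : EuclideanSpace ℝ (Fin d) → ENNReal := {y | m < ‖F y‖}.indicator fun y => ‖F y‖ₑ with hψ
  have hS : MeasurableSet {y | m < ‖F y‖} :=
    measurableSet_lt measurable_const hFm.norm.measurable
  have hψm : Measurable ψ := hFm.enorm.indicator hS
  have hKm : Measurable fun t => ENNReal.ofReal (rieszKernel d s t) :=
    (measurable_rieszKernel d s).ennreal_ofReal
  set G : EuclideanSpace ℝ (Fin d) → ENNReal := fun x =>
    ∫⁻ t in Metric.ball 0 R, ENNReal.ofReal (rieszKernel d s t) * ψ (x - t) with hG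
  have hGm : Measurable G := by
    have : Measurable fun q : EuclideanSpace ℝ (Fin d) × EuclideanSpace ℝ (Fin d) =>
        ENNReal.ofReal (rieszKernel d s q.2) * ψ (q.1 - q.2) :=
      (hKm.comp measurable_snd).mul (hψm.comp (measurable_fst.sub measurable_snd))
    exact this.lintegral_prod_right'
  have hGi : ∫⁻ x, G x = ENNReal.ofReal (B * m ^ (θ - 1)) * ∫⁻ x, ψ x := by
    rw [hG, lintegral_lintegral_mul_sub hKm hψm, ← ofReal_integral_eq_lintegral_ofReal hbi
      (ae_of_all _ fun t => rieszKernel_nonneg d s t), hbe, hRs]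
  have hsub : volume {x | 2 * D * m ^ θ < ‖∫ t, rieszKernel d s t • F (x - t)‖}
      ≤ volume {x | ENNReal.ofReal (D * m ^ θ) ≤ G x} := by
    refine measure_mono_ae ?_
    filter_upwards [ae_integrable_rieszKernel_smul hs0 hsd hFm hF] with x hx
      (hlt : 2 * D * m ^ θ < ‖∫ t, rieszKernel d s t • F (x - t)‖)
    have h := enorm_integral_rieszKernel_smul_le hm.le hx hbi hbe (hfar x)
    rw [hRs, mul_assoc B, hmθ, ← add_mul, ← ofReal_norm] at h
    have h' := (ENNReal.ofReal_le_ofReal hlt.le).trans h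
    rw [mul_assoc, two_mul, ENNReal.ofReal_add (by positivity) (by positivity)] at h'
    exact (ENNReal.add_le_add_iff_left ENNReal.ofReal_ne_top).1 h'
  have hψi : ∫⁻ x, ψ x = ∫⁻ x in {x | m < ‖F x‖}, ENNReal.ofReal ‖F x‖ := by
    simp_rw [hψ, ofReal_norm]
    exact lintegral_indicator hS _
  have hmark := mul_meas_ge_le_lintegral hGm (μ := volume) (ENNReal.ofReal (D * m ^ θ))
  have hc : ENNReal.ofReal (D * m ^ (θ - 1)) ≠ 0 := by
    rw [Ne, ENNReal.ofReal_eq_zero, not_le]; positivity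
  -- The factor `D * m ^ (θ - 1)` turns `m` into Markov's threshold `D * m ^ θ`; the mass of the
  -- near kernel is `B * m ^ (θ - 1)`, and `B ≤ D`.
  rw [← hψi, ← ENNReal.mul_le_mul_iff_right hc ENNReal.ofReal_ne_top]
  calc _ = ENNReal.ofReal (D * m ^ θ) *
        volume {x | 2 * D * m ^ θ < ‖∫ t, rieszKernel d s t • F (x - t)‖} := by
        have e : ENNReal.ofReal (D * m ^ θ) = ENNReal.ofReal (D * m ^ (θ - 1)) *
            ENNReal.ofReal m := by
          rw [← hmθ, ← mul_assoc D, ENNReal.ofReal_mul (by positivity)]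
        rw [e, mul_assoc (ENNReal.ofReal _), mul_comm (ENNReal.ofReal m)]
    _ ≤ ENNReal.ofReal (D * m ^ θ) * volume {x | ENNReal.ofReal (D * m ^ θ) ≤ G x} := by
        gcongr
    _ ≤ ENNReal.ofReal (B * m ^ (θ - 1)) * ∫⁻ x, ψ x := hmark.trans_eq hGi
    _ ≤ _ := by
        gcongr
        rw [hD]
        exact le_add_of_nonneg_left (Real.sqrt_nonneg A)

/-! ### The strong bound and the theorem -/

theorem stronglyMeasurable_integral_rieszKernel_smul {d : ℕ} (s : ℝ) {V : Type*}
    [NormedAddCommGroup V] [NormedSpace ℝ V] {F : EuclideanSpace ℝ (Fin d) → V}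
    (hFm : StronglyMeasurable F) :
    StronglyMeasurable fun x => ∫ t, rieszKernel d s t • F (x - t) := by
  refine StronglyMeasurable.integral_prod_right (f := fun x t => rieszKernel d s t • F (x - t)) ?_
  exact ((measurable_rieszKernel d s).comp measurable_snd).stronglyMeasurable.smul
    (hFm.comp_measurable (measurable_fst.sub measurable_snd))

open Set in
theorem exists_lintegral_norm_integral_rieszKernel_rpow_le {d : ℕ} {s : ℝ} (hs0 : 0 < s)
    (hsd : s < (d : ℝ) / 2) :
    ∃ C : ℝ, 0 < C ∧ ∀ (N : ℕ) (F : EuclideanSpace ℝ (Fin d) → EuclideanSpace ℂ (Fin N)),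
      StronglyMeasurable F → MemLp F 2 →
      (∀ φ : EuclideanSpace ℝ (Fin d) → ℝ, MemLp φ 2 → ∀ x,
        ‖∫ t, φ t • F (x - t)‖ ^ 2 ≤ ∫ t, φ t ^ 2) →
      ∫⁻ x, ENNReal.ofReal ((‖∫ t, rieszKernel d s t • F (x - t)‖ ^ 2) ^
          ((d : ℝ) / ((d : ℝ) - 2 * s)))
        ≤ ENNReal.ofReal C * ∫⁻ x, ENNReal.ofReal (‖F x‖ ^ 2) := by
  have hd' : (0 : ℝ) < d := by linarith
  have h2s : (0 : ℝ) < d - 2 * s := by linarith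
  obtain ⟨D, hD, hDm⟩ := exists_meas_lt_norm_integral_rieszKernel_mul_le hs0 hsd
  set p := (d : ℝ) / ((d : ℝ) - 2 * s) with hp
  have hp0 : 0 < p := by positivity
  have hpi : ((d : ℝ) - 2 * s) / d = p⁻¹ := by rw [hp, inv_div]
  refine ⟨((2 * D) ^ p) ^ 2 * 2, by positivity, fun N F hFm hF hBes => ?_⟩
  have hU := stronglyMeasurable_integral_rieszKernel_smul s hFm
  set U := fun x => ∫ t, rieszKernel d s t • F (x - t)
  -- As `θ = 1/p`, the level `2 * D * m ^ θ` of `‖U‖` is the level `m` of this `h`, and `h ^ 2` is a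
  -- multiple of `‖U‖ ^ (2p)`.
  have key := lintegral_sq_le_of_meas_lt_mul_le (μ := volume) (h := fun x => (‖U x‖ / (2 * D)) ^ p)
    (g := fun x => ‖F x‖) (fun x => by positivity)
    ((hU.norm.measurable.div_const _).pow_const p).aemeasurable
    (fun x => norm_nonneg _) hFm.norm.measurable (fun m hm => by
      refine le_trans ?_ (hDm N F hFm hF hBes m hm)
      gcongr ?_ * _
      refine measure_mono fun x (hx : m < (‖U x‖ / (2 * D)) ^ p) => ?_
      change 2 * D * m ^ (((d : ℝ) - 2 * s) / d) < ‖U x‖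
      rw [hpi, mul_comm, ← lt_div_iff₀ (by positivity), Real.rpow_inv_lt_iff_of_pos hm.le
        (by positivity) hp0]
      exact hx)
  rw [ENNReal.ofReal_mul (by positivity), mul_assoc, ENNReal.ofReal_ofNat]
  refine le_trans (le_of_eq ?_) (mul_le_mul_right key _)
  rw [← lintegral_const_mul' _ _ ENNReal.ofReal_ne_top]
  refine lintegral_congr fun x => ?_
  rw [← ENNReal.ofReal_mul (by positivity), Real.rpow_two, ← mul_pow,
    ← Real.mul_rpow (by positivity) (by positivity), mul_div_cancel₀ _ (by positivity),
    ← Real.rpow_natCast, ← Real.rpow_natCast, ← Real.rpow_mul (by positivity),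
    ← Real.rpow_mul (by positivity), mul_comm]

theorem mainTheorem1 (d : ℕ) (s : ℝ) (hs0 : 0 < s) (hsd : s < (d : ℝ) / 2) :
    ∃ C : ℝ, 0 < C ∧
      ∀ (N : ℕ) (f : Fin N → Lp ℂ 2 (volume : Measure (EuclideanSpace ℝ (Fin d)))),
        Orthonormal ℂ f →
          (∀ n : Fin N, ∀ᵐ x : EuclideanSpace ℝ (Fin d), RieszConvExistsAt d s (f n) x) ∧
          Integrable (fun x : EuclideanSpace ℝ (Fin d) =>
            (∑ n : Fin N, ‖rieszConv d s (f n) x‖ ^ 2) ^ ((d : ℝ) / ((d : ℝ) - 2 * s))) volume ∧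
          ∫ x : EuclideanSpace ℝ (Fin d),
            (∑ n : Fin N, ‖rieszConv d s (f n) x‖ ^ 2) ^ ((d : ℝ) / ((d : ℝ) - 2 * s))
              ≤ C * N := by
  obtain ⟨C, hC, hmain⟩ := exists_lintegral_norm_integral_rieszKernel_rpow_le hs0 hsd
  refine ⟨C, hC, fun N f hf => ?_⟩
  have hex : ∀ n, ∀ᵐ x, RieszConvExistsAt d s (f n) x := fun n =>
    ae_integrable_rieszKernel_smul hs0 hsd (Lp.stronglyMeasurable (f n)) (Lp.memLp (f n))
  set F : EuclideanSpace ℝ (Fin d) → EuclideanSpace ℂ (Fin N) :=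
    fun x => WithLp.toLp 2 fun n => f n x
  have hFm : StronglyMeasurable F :=
    ((PiLp.continuous_toLp 2 fun _ : Fin N => ℂ).measurable.comp
      (measurable_pi_lambda _ fun n => (Lp.stronglyMeasurable (f n)).measurable)).stronglyMeasurable
  have hF : MemLp F 2 := MemLp.of_eval_piLp fun n => Lp.memLp (f n)
  -- All components must be integrable: otherwise the vector integral defaults to 0 while some
  -- component integrals may not vanish.
  have hcoord : ∀ (φ : EuclideanSpace ℝ (Fin d) → ℝ) (x : EuclideanSpace ℝ (Fin d)),
      (∀ n, Integrable fun t => φ t • f n (x - t)) →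
      ‖∫ t, φ t • F (x - t)‖ ^ 2 = ∑ n, ‖∫ t, φ t • f n (x - t)‖ ^ 2 := fun φ x h => by
    rw [EuclideanSpace.norm_sq_eq]
    refine Finset.sum_congr rfl fun n _ => ?_
    rw [eval_integral_piLp (f := fun t => φ t • F (x - t)) h]
    rfl
  have hBes : ∀ φ : EuclideanSpace ℝ (Fin d) → ℝ, MemLp φ 2 → ∀ x,
      ‖∫ t, φ t • F (x - t)‖ ^ 2 ≤ ∫ t, φ t ^ 2 := fun φ hφ x => by
    rw [hcoord φ x fun n => integrable_smul_sub_of_memLp_two hφ (Lp.memLp (f n)) x]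
    exact sum_norm_integral_smul_sub_sq_le hf hφ x
  have hmass : ∫⁻ x, ENNReal.ofReal (‖F x‖ ^ 2) = N := by
    have h1 : ∀ n, ∫⁻ x, ENNReal.ofReal (‖f n x‖ ^ 2) = 1 := fun n => by
      have h := Lp.enorm_def (f n)
      rw [eLpNorm_eq_lintegral_rpow_enorm_toReal two_ne_zero ENNReal.ofNat_ne_top,
        ← ofReal_norm, hf.1 n, ENNReal.ofReal_one, eq_comm] at h
      have h2 := congrArg (· ^ (2 : ℝ)) h
      simp only [ENNReal.toReal_ofNat, ← ENNReal.rpow_mul, ENNReal.one_rpow] at h2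
      norm_num at h2
      rw [← h2]
      refine lintegral_congr fun x => ?_
      rw [ENNReal.ofReal_pow (norm_nonneg _), ofReal_norm]
    simp_rw [EuclideanSpace.norm_sq_eq]
    calc _ = ∫⁻ x, ∑ n, ENNReal.ofReal (‖f n x‖ ^ 2) :=
          lintegral_congr fun x => ENNReal.ofReal_sum_of_nonneg fun n _ => by positivity
      _ = ∑ n, ∫⁻ x, ENNReal.ofReal (‖f n x‖ ^ 2) := lintegral_finsetSum _ fun n _ =>
          ((Lp.stronglyMeasurable (f n)).norm.measurable.pow_const 2).ennreal_ofReal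
      _ = N := by
        simp only [h1]
        simp
  have hae : ∀ᵐ x, ‖∫ t, rieszKernel d s t • F (x - t)‖ ^ 2
      = ∑ n, ‖rieszConv d s (f n) x‖ ^ 2 := by
    filter_upwards [ae_all_iff.2 hex] with x hx
    exact hcoord _ x hx
  have hbound := hmain N F hFm hF hBes
  rw [hmass, lintegral_congr_ae (hae.mono fun x hx => by rw [hx])] at hbound
  have hmeas : Measurable fun x : EuclideanSpace ℝ (Fin d) =>
      (∑ n : Fin N, ‖rieszConv d s (f n) x‖ ^ 2) ^ ((d : ℝ) / ((d : ℝ) - 2 * s)) := by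
    refine (Finset.measurable_sum _ fun n _ => ?_).pow_const _
    exact (stronglyMeasurable_integral_rieszKernel_smul s
      (Lp.stronglyMeasurable (f n))).norm.measurable.pow_const 2
  have hnn : ∀ x, 0 ≤ (∑ n : Fin N, ‖rieszConv d s (f n) x‖ ^ 2) ^
      ((d : ℝ) / ((d : ℝ) - 2 * s)) := fun x => by positivity
  refine ⟨hex, ⟨hmeas.aestronglyMeasurable, ?_⟩, ?_⟩
  · rw [hasFiniteIntegral_iff_ofReal (ae_of_all _ hnn)]
    exact hbound.trans_lt (ENNReal.mul_lt_top ENNReal.ofReal_lt_top (ENNReal.natCast_lt_top N))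
  · rw [integral_eq_lintegral_of_nonneg_ae (ae_of_all _ hnn) hmeas.aestronglyMeasurable]
    refine (ENNReal.toReal_mono (by finiteness) hbound).trans_eq ?_
    rw [ENNReal.toReal_mul, ENNReal.toReal_ofReal hC.le, ENNReal.toReal_natCast]
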